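/- A numeration system is a strictly increasing sequence $U=(U_n)_{n\ge 0}$ of integers with $U_0=1$ and $C_U:=\sup_n\lceil U_{n+1}/U_n\rceil<\infty$; put $A_U=\{0,\dots,C_U-1\}$. The greedy representation $\mathrm{rep}_U(n)$ of $n\ge 0$ is the word $w_{\ell-1}\cdots w_0$ over $A_U$ without leading zero such that $\sum_{i<\ell}w_iU_i=n$ and $\sum_{i<j}w_iU_i<U_j$ for $1\le j\le \ell$ (so $\mathrm{rep}_U(0)=\varepsilon$). A set $X\subseteq\mathbb N$ is $U$-recognizable if $\mathrm{rep}_U(X)$ is a regular language. An infinite word $(x_n)_{n\ge0}$ is $U$-automatic if there is a complete deterministic finite automaton with output $(Q,q_0,A_U,\delta,\tau)$ with $\delta(q_0,0)=q_0$ and $x_n=\tau(\delta(q_0,\mathrm{rep}_U(n)))$ for all $n\ge0$. For a real $\beta>1$ and $x\in[0,1]$, the $\beta$-expansion $d_\beta(x)$ is the lexicographically greatest sequence $(x_i)_{i\ge1}\in\mathbb N^\omega$ with $x=\sum_{i\ge1}x_i\beta^{-i}$. If $d_\beta(1)=t_1\cdots t_m0^\omega$ with $t_m\ne0$, let $d^*_\beta(1)=(t_1\cdots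 t_{m-1}(t_m-1))^\omega$; otherwise let $d^*_\beta(1)=d_\beta(1)$. The number $\beta$ is a Parry number if $d^*_\beta(1)=(t_i)_{i\ge1}$ is ultimately periodic, and then the sequence defined by $U_n=t_1U_{n-1}+\cdots+t_nU_0+1$ for all $n\ge0$ is the Parry numeration system canonically associated with $\beta$. A sequence is aperiodic if it is not ultimately periodic. **Theorem.** Let $U_0=1$, $U_1=4$, $U_2=15$, $U_3=54$ and $U_n=3U_{n-1}+2U_{n-2}+3U_{n-4}$ for $n\ge4$, and let $\beta\approx3.61645$ be the largest real root of $X^4-3X^3-2X^2-3$. Then $\beta$ is a Parry number, and $U$ is a numeration system and is the Parry numeration system canonically associated with $\beta$. Moreover: 1. The $\beta$-expansion of $1/2$ is aperiodic. 2. The set $\{U_n/2 : n\ge0,\ U_n \text{ even}\}$ is not $U$-recognizable, and neither is the set $\{\lfloor U_n/2\rfloor : n\ge0\}$. 3. The characteristic sequence $\mathbf x$ of $\{U_n : n\ge0\}$ is $U$-automatic. The sequence $\mathbf y$ with $\mathbf y[n]=\mathbf x[2n]$, obtained from $\mathbf x$ by deleting every second letter, is the characteristic sequence of $\{U_n/2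 : n\ge0,\ U_n\text{ even}\}$, and it is not $U$-automatic. Consequently there is a Parry numeration system $U$, namely the one above, for which the class of $U$-automatic sequences (over finite alphabets) is not closed under periodic deletion, that is, under the operations $(x_n)_{n\ge0}\mapsto(x_{tn})_{n\ge0}$ with $t\ge2$. -/

import Mathlib

/-- `s` is eventually periodic (ultimately periodic); a sequence is aperiodic if it is not. -/
def IsUltimatelyPeriodic (s : ℕ → ℕ) : Prop :=
  ∃ N p : ℕ, 0 < p ∧ ∀ n, N ≤ n → s (n + p) = s n

/-! ### Expansions of real numbers

Sequences of digits are indexed from `0`: the entry `d i` is the digit with weight `β ^ (-(i + 1))`. -/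

/-- `d` is the `β`-expansion of `x`: the lexicographically greatest sequence of natural numbers
with `x = ∑ d i * β ^ (-(i + 1))`. -/
def IsBetaExpansion (β x : ℝ) (d : ℕ → ℕ) : Prop :=
  IsGreatest {e : Lex (ℕ → ℕ) | HasSum (fun i : ℕ => (ofLex e i : ℝ) / β ^ (i + 1)) x} (toLex d)

/-- `t` is the modified expansion `d*_β(1)`. If `d_β(1) = t₁ ⋯ tₘ 0 0 0 ⋯` is finite with `tₘ ≠ 0`
(below, the last nonzero digit has index `m`, so that the finite part has length `m + 1`), it is the
periodic sequence with period `t₁ ⋯ tₘ₋₁ (tₘ - 1)`; otherwise it is `d_β(1)`. -/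
def IsModifiedExpansionOne (β : ℝ) (t : ℕ → ℕ) : Prop :=
  ∃ d : ℕ → ℕ, IsBetaExpansion β 1 d ∧
    ((∃ m : ℕ, d m ≠ 0 ∧ (∀ i, m < i → d i = 0) ∧
        ∀ i, t i = if i % (m + 1) = m then d m - 1 else d (i % (m + 1))) ∨
      ((∀ m : ℕ, ∃ i, m < i ∧ d i ≠ 0) ∧ t = d))

/-- Parry numbers. -/
def IsParryNumber (β : ℝ) : Prop :=
  1 < β ∧ ∃ t : ℕ → ℕ, IsModifiedExpansionOne β t ∧ IsUltimatelyPeriodic t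

/-- `U` is the numeration system canonically associated with `β`:
`U n = t₁ U (n - 1) + ⋯ + tₙ U 0 + 1` for all `n`, where `d*_β(1) = t₁ t₂ ⋯`. -/
def IsCanonicalSystem (β : ℝ) (U : ℕ → ℕ) : Prop :=
  ∃ t : ℕ → ℕ, IsModifiedExpansionOne β t ∧
    ∀ n, U n = ∑ i ∈ Finset.range n, t i * U (n - 1 - i) + 1

/-! ### Positional numeration systems -/

/-- Positional numeration systems: increasing, `U 0 = 1`, and the numbers `⌈U (n + 1) / U n⌉`
are bounded. -/
def IsNumerationSystem (U : ℕ → ℕ) : Prop :=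
  StrictMono U ∧ U 0 = 1 ∧
    BddAbove (Set.range fun n : ℕ => ⌈(U (n + 1) : ℚ) / (U n : ℚ)⌉₊)

/-- The size `C_U = sup ⌈U (n + 1) / U n⌉` of the digit alphabet. -/
noncomputable def alphabetSize (U : ℕ → ℕ) : ℕ :=
  ⨆ n : ℕ, ⌈(U (n + 1) : ℚ) / (U n : ℚ)⌉₊

/-- The digit alphabet `A_U = {0, …, C_U - 1}`. -/
abbrev Digit (U : ℕ → ℕ) : Type := Fin (alphabetSize U)

/-- The numerical value of a word, most significant digit first. -/
def wordVal (U : ℕ → ℕ) : List (Digit U) → ℕ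
  | [] => 0
  | a :: w => (a : ℕ) * U w.length + wordVal U w

/-- `w` is the greedy representation of `n`: it has value `n`, no leading zero, and every nonempty
suffix of length `j` has value less than `U j`. The empty word represents `0`, and only `0`. -/
def IsGreedyRep (U : ℕ → ℕ) (n : ℕ) (w : List (Digit U)) : Prop :=
  wordVal U w = n ∧ (∀ a ∈ w.head?, (a : ℕ) ≠ 0) ∧
    ∀ v : List (Digit U), v <:+ w → v ≠ [] → wordVal U v < U v.length

/-- The language of the greedy representations of the elements of `X`. -/
def repLanguage (U : ℕ → ℕ) (X : Set ℕ) : Language (Digit U) :=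
  {w | ∃ n ∈ X, IsGreedyRep U n w}

/-- `X` is `U`-recognizable: its greedy representations form a regular language. -/
def IsRecognizable (U : ℕ → ℕ) (X : Set ℕ) : Prop :=
  (repLanguage U X).IsRegular

/-! ### Automatic sequences -/

/-- Complete deterministic finite automata with output, over the input alphabet `A`, with states `Q`
and outputs in `B`. -/
structure DFAO (A Q B : Type) where
  start : Q
  step : Q → A → Q
  out : Q → B

/-- The output after reading a word. -/
def DFAO.eval {A Q B : Type} (M : DFAO A Q B) (w : List A) : B :=
  M.out (w.foldl M.step M.start)

/-- `x` is `U`-automatic: a DFAO, with a loop labelled `0` at its initial state, outputs `x n` after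
reading the greedy representation of `n`. -/
def IsAutomatic (U : ℕ → ℕ) {B : Type} (x : ℕ → B) : Prop :=
  ∃ (Q : Type) (_ : Finite Q) (M : DFAO (Digit U) Q B),
    (∀ a : Digit U, (a : ℕ) = 0 → M.step M.start a = M.start) ∧
      ∀ n, ∃ w, IsGreedyRep U n w ∧ x n = M.eval w

/-- The class of `U`-automatic sequences is closed under periodic deletion, that is, under keeping
only the letters at the positions `0, t, 2t, 3t, …`, for every `t ≥ 2`. -/
def ClosedUnderPeriodicDeletion (U : ℕ → ℕ) : Prop :=
  ∀ (B : Type) [Finite B] (x : ℕ → B), IsAutomatic U x →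
    ∀ t : ℕ, 2 ≤ t → IsAutomatic U (fun n => x (t * n))

open Classical in
/-- The characteristic sequence of a set of natural numbers, an infinite word over `{0, 1}`. -/
noncomputable def charSeq (X : Set ℕ) (n : ℕ) : Fin 2 :=
  if n ∈ X then 1 else 0

/-! ### The specific numeration system -/

/-- `U₀ = 1`, `U₁ = 4`, `U₂ = 15`, `U₃ = 54` and `Uₙ = 3 Uₙ₋₁ + 2 Uₙ₋₂ + 3 Uₙ₋₄`. -/
def seqU : ℕ → ℕ
  | 0 => 1
  | 1 => 4
  | 2 => 15
  | 3 => 54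
  | n + 4 => 3 * seqU (n + 3) + 2 * seqU (n + 2) + 3 * seqU n

/-- The set of all `Uₙ / 2` with `Uₙ` even. -/
def halfEvenU : Set ℕ := {m | ∃ n, Even (seqU n) ∧ m = seqU n / 2}

open Filter Topology

/-! ### Expansions from remainders -/

/-! The obstruction to halving is that `β`, although a Parry number, has a real conjugate `γ` in
`[-1.1, -1.096]`, outside the unit disc. Twice each greedy remainder of `1 / 2` is an integer cubic
polynomial in `β`. The same polynomials evaluated at `γ` give an orbit `g (n + 1) = γ * g n - 2 * d
n` with digits at most 3. Once `|g n|` is large enough, its absolute value increases strictly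
forever, and computing thirty digits shows that this happens. A periodic expansion would make two
remainders equal; since `1, β, β ^ 2, β ^ 3` are independent over `ℤ`, two values of `g` would then
agree, a contradiction (`not_isUltimatelyPeriodic_greedyDigit_half`).

This passes to integers by a limit. The greedy word of `seqU n / 2` has length `n`, and `seqU (n +
1) / seqU n` tends to `β`, so each fixed digit of that word, counted from the left, is eventually
the digit of the expansion of `1 / 2` (`tendsto_digits`). If infinitely many of these words formed a
regular language, pumping one of them would force the limit word to be ultimately periodic
(`not_isRegular_of_tendsto_aperiodic`).

The numbers `seqU n` themselves have representations `1 0 ⋯ 0`, so their characteristic sequence is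
automatic. An automatic sequence has recognizable fibres because the greedy words are the words
accepted by the finite automaton of `(3202)^ω`. Hence keeping the even positions destroys
automaticity. -/

lemma sum_digits_eq_sub_remainder {β : ℝ} (hβ : 1 < β) {d : ℕ → ℕ} {r : ℕ → ℝ}
    (hs : ∀ n, r (n + 1) = β * r n - d n) (n : ℕ) :
    ∑ i ∈ Finset.range n, (d i : ℝ) / β ^ (i + 1) = r 0 - r n / β ^ n := by
  have h0 : β ≠ 0 := by positivity
  induction n with
  | zero => simp
  | succ n ih =>
    rw [Finset.sum_range_succ, ih, hs]
    field_simp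
    ring

/-- A digit sequence whose remainders lie in `[0, 1)` is a `β`-expansion. -/
lemma isBetaExpansion_of_remainders {β : ℝ} (hβ : 1 < β) {d : ℕ → ℕ} {r : ℕ → ℝ}
    (hs : ∀ n, r (n + 1) = β * r n - d n) (hr : ∀ n, 0 ≤ r (n + 1) ∧ r (n + 1) < 1) :
    IsBetaExpansion β (r 0) d := by
  have hpos : 0 < β := by positivity
  have hnn (e : ℕ → ℕ) (i : ℕ) : 0 ≤ (e i : ℝ) / β ^ (i + 1) := by positivity
  constructor
  · change HasSum (fun i : ℕ => (d i : ℝ) / β ^ (i + 1)) (r 0)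
    rw [hasSum_iff_tendsto_nat_of_nonneg (hnn d)]
    simp_rw [sum_digits_eq_sub_remainder hβ hs]
    have hlim : Tendsto (fun n => r n / β ^ n) atTop (𝓝 0) := by
      have h1 : Tendsto (fun n : ℕ => (1 / β) ^ n) atTop (𝓝 0) :=
        tendsto_pow_atTop_nhds_zero_of_lt_one (by positivity)
          (by rw [div_lt_one hpos]; exact hβ)
      refine squeeze_zero' ?_ ?_ h1
      · filter_upwards [eventually_ge_atTop 1] with n hn
        obtain ⟨m, rfl⟩ := Nat.exists_eq_add_of_le' hn
        have := (hr m).1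
        positivity
      · filter_upwards [eventually_ge_atTop 1] with n hn
        obtain ⟨m, rfl⟩ := Nat.exists_eq_add_of_le' hn
        rw [one_div_pow]
        have := (hr m).2.le
        gcongr
    simpa using hlim.const_sub (r 0)
  · intro e he
    replace he : HasSum (fun i : ℕ => (ofLex e i : ℝ) / β ^ (i + 1)) (r 0) := he
    by_contra hlt
    rw [not_le] at hlt
    obtain ⟨i, hi, hlt⟩ := hlt
    change ∀ j, j < i → d j = ofLex e j at hi
    change d i < ofLex e i at hlt
    have h1 := sum_le_hasSum (Finset.range (i + 1)) (fun j _ => hnn (ofLex e) j) he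
    have h2 := sum_digits_eq_sub_remainder hβ hs (i + 1)
    rw [Finset.sum_range_succ] at h1 h2
    have h3 : ∑ j ∈ Finset.range i, (ofLex e j : ℝ) / β ^ (j + 1)
        = ∑ j ∈ Finset.range i, (d j : ℝ) / β ^ (j + 1) :=
      Finset.sum_congr rfl fun j hj => by rw [hi j (Finset.mem_range.1 hj)]
    -- At the first difference, a larger digit costs at least one more unit of `β ^ (-(i + 1))`,
    -- while less than one such unit remains.
    have h4 : ((d i : ℝ) + 1) / β ^ (i + 1) ≤ (ofLex e i : ℝ) / β ^ (i + 1) := by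
      gcongr
      exact_mod_cast hlt
    have h5 : r (i + 1) / β ^ (i + 1) < 1 / β ^ (i + 1) := by
      have := (hr i).2
      gcongr
    rw [add_div] at h4
    linarith

/-- The remainders of the greedy algorithm. -/
noncomputable def greedyRemainder (β x : ℝ) : ℕ → ℝ
  | 0 => x
  | n + 1 => Int.fract (β * greedyRemainder β x n)

/-- The digits of the greedy algorithm. -/
noncomputable def greedyDigit (β x : ℝ) (n : ℕ) : ℕ := ⌊β * greedyRemainder β x n⌋₊

section Greedy

variable {β x : ℝ}

lemma greedyRemainder_succ_mem (n : ℕ) :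
    0 ≤ greedyRemainder β x (n + 1) ∧ greedyRemainder β x (n + 1) < 1 :=
  ⟨Int.fract_nonneg _, Int.fract_lt_one _⟩

lemma greedyRemainder_mem (hx : 0 ≤ x) (hx' : x < 1) (n : ℕ) :
    0 ≤ greedyRemainder β x n ∧ greedyRemainder β x n < 1 := by
  cases n with
  | zero => exact ⟨hx, hx'⟩
  | succ n => exact greedyRemainder_succ_mem n

lemma greedyRemainder_succ (hβ : 1 < β) (hx : 0 ≤ x) (hx' : x < 1) (n : ℕ) :
    greedyRemainder β x (n + 1) = β * greedyRemainder β x n - greedyDigit β x n := by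
  have h : 0 ≤ β * greedyRemainder β x n :=
    mul_nonneg (by positivity) (greedyRemainder_mem hx hx' n).1
  rw [greedyRemainder, greedyDigit, Int.fract, natCast_floor_eq_intCast_floor h]

lemma isBetaExpansion_greedyDigit (hβ : 1 < β) (hx : 0 ≤ x) (hx' : x < 1) :
    IsBetaExpansion β x (greedyDigit β x) :=
  isBetaExpansion_of_remainders hβ (greedyRemainder_succ hβ hx hx') greedyRemainder_succ_mem

/-- If the greedy digits are periodic from some point on, so are the remainders. -/
lemma greedyRemainder_periodic (hβ : 1 < β) (hx : 0 ≤ x) (hx' : x < 1) {N p : ℕ}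
    (h : ∀ n, N ≤ n → greedyDigit β x (n + p) = greedyDigit β x n) {n : ℕ} (hn : N ≤ n) :
    greedyRemainder β x (n + p) = greedyRemainder β x n := by
  set r := greedyRemainder β x with hr
  -- Equal digits cancel, so the gap between the two orbits is multiplied by `β` at each step; as it
  -- stays below 1, it must be zero.
  have key (k : ℕ) : r (n + k + p) - r (n + k) = β ^ k * (r (n + p) - r n) := by
    induction k with
    | zero => simp
    | succ k ih =>
      have h1 := greedyRemainder_succ hβ hx hx' (n + k + p)
      have h2 := greedyRemainder_succ hβ hx hx' (n + k)
      rw [h (n + k) (by omega), ← hr] at h1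
      rw [← hr] at h2
      rw [show n + (k + 1) + p = n + k + p + 1 by ring, show n + (k + 1) = n + k + 1 by ring,
        h1, h2, pow_succ]
      linear_combination β * ih
  by_contra hne
  have hpos : 0 < |r (n + p) - r n| := abs_pos.2 (sub_ne_zero.2 hne)
  obtain ⟨k, hk⟩ := pow_unbounded_of_one_lt (1 / |r (n + p) - r n|) hβ
  rw [div_lt_iff₀ hpos] at hk
  have h1 := greedyRemainder_mem (β := β) hx hx' (n + k + p)
  have h2 := greedyRemainder_mem (β := β) hx hx' (n + k)
  rw [← hr] at h1 h2
  have h3 : |r (n + k + p) - r (n + k)| < 1 := by rw [abs_lt]; constructor <;> linarith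
  rw [key, abs_mul, abs_of_pos (by positivity : 0 < β ^ k)] at h3
  linarith

end Greedy

/-! ### The roots of `X ^ 4 - 3 X ^ 3 - 2 X ^ 2 - 3` -/

lemma exists_root_mem_Icc {a b : ℝ} (hab : a ≤ b)
    (h : 0 ∈ Set.uIcc (a ^ 4 - (3 * a ^ 3 + 2 * a ^ 2 + 3)) (b ^ 4 - (3 * b ^ 3 + 2 * b ^ 2 + 3))) :
    ∃ z, a ≤ z ∧ z ≤ b ∧ z ^ 4 = 3 * z ^ 3 + 2 * z ^ 2 + 3 := by
  have hc : ContinuousOn (fun z : ℝ => z ^ 4 - (3 * z ^ 3 + 2 * z ^ 2 + 3)) (Set.uIcc a b) := by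
    fun_prop
  obtain ⟨z, hz, hz0⟩ := intermediate_value_uIcc hc h
  rw [Set.uIcc_of_le hab] at hz
  exact ⟨z, hz.1, hz.2, sub_eq_zero.1 hz0⟩

lemma exists_dominant_root : ∃ β : ℝ, 3.6164545 ≤ β ∧ β ≤ 3.6164546 ∧
    β ^ 4 = 3 * β ^ 3 + 2 * β ^ 2 + 3 := by
  refine exists_root_mem_Icc (by norm_num) ?_
  rw [Set.uIcc_of_le (by norm_num)]
  constructor <;> norm_num

lemma exists_negative_root : ∃ γ : ℝ, -1.1 ≤ γ ∧ γ ≤ -1.096 ∧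
    γ ^ 4 = 3 * γ ^ 3 + 2 * γ ^ 2 + 3 := by
  refine exists_root_mem_Icc (by norm_num) ?_
  rw [Set.uIcc_of_ge (by norm_num)]
  constructor <;> norm_num

/-- After division by `z ^ 4` the equation reads `3 / z + 2 / z ^ 2 + 3 / z ^ 4 = 1`, whose left
side is strictly decreasing for `z > 0`. -/
lemma isGreatest_dominant_root {β : ℝ} (h : 3.6 ≤ β) (hβ : β ^ 4 = 3 * β ^ 3 + 2 * β ^ 2 + 3) :
    IsGreatest {z : ℝ | z ^ 4 = 3 * z ^ 3 + 2 * z ^ 2 + 3} β := by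
  refine ⟨hβ, fun z hz => ?_⟩
  replace hz : z ^ 4 = 3 * z ^ 3 + 2 * z ^ 2 + 3 := hz
  by_contra! hlt
  have h0 : 0 < β := by linarith
  have h1 : 0 < z := by linarith
  have e1 : 3 / β + 2 / β ^ 2 + 3 / β ^ 4 = 1 := by field_simp; linarith
  have e2 : 3 / z + 2 / z ^ 2 + 3 / z ^ 4 = 1 := by field_simp; linarith
  have i1 : 3 / z < 3 / β := by gcongr
  have i2 : 2 / z ^ 2 < 2 / β ^ 2 := by gcongr
  have i3 : 3 / z ^ 4 < 3 / β ^ 4 := by gcongr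
  linarith

/-! ### The lattice `ℤ[X] / (X ^ 4 - 3 X ^ 3 - 2 X ^ 2 - 3)` -/

/-- The value at `z` of a cubic polynomial given by its coefficients. -/
def cubicEval (z : ℝ) (v : ℤ × ℤ × ℤ × ℤ) : ℝ :=
  v.1 + v.2.1 * z + v.2.2.1 * z ^ 2 + v.2.2.2 * z ^ 3

/-- Multiplication by the root, followed by subtraction of `2 k`. -/
def mulRootSub (k : ℤ) (v : ℤ × ℤ × ℤ × ℤ) : ℤ × ℤ × ℤ × ℤ :=
  (3 * v.2.2.2 - 2 * k, v.1, v.2.1 + 2 * v.2.2.2, v.2.2.1 + 3 * v.2.2.2)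

lemma cubicEval_mulRootSub {z : ℝ} (hz : z ^ 4 = 3 * z ^ 3 + 2 * z ^ 2 + 3) (k : ℤ)
    (v : ℤ × ℤ × ℤ × ℤ) : cubicEval z (mulRootSub k v) = z * cubicEval z v - 2 * k := by
  simp only [cubicEval, mulRootSub]
  push_cast
  linear_combination (-(v.2.2.2 : ℝ)) * hz

/-- The matrix of the multiplication by a cubic polynomial. -/
def cubicMatrix {R : Type*} [CommRing R] (a b c d : R) : Matrix (Fin 4) (Fin 4) R :=
  !![a, b, c, d;
     3 * d, a, b + 2 * d, c + 3 * d;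
     3 * (c + 3 * d), 3 * d, a + 2 * (c + 3 * d), b + 2 * d + 3 * (c + 3 * d);
     3 * (b + 2 * d + 3 * (c + 3 * d)), 3 * (c + 3 * d),
       3 * d + 2 * (b + 2 * d + 3 * (c + 3 * d)),
       a + 2 * (c + 3 * d) + 3 * (b + 2 * d + 3 * (c + 3 * d))]

lemma cubicMatrix_map {R S : Type*} [CommRing R] [CommRing S] (f : R →+* S) (a b c d : R) :
    f (cubicMatrix a b c d).det = (cubicMatrix (f a) (f b) (f c) (f d)).det := by
  rw [RingHom.map_det]
  congr 1
  ext i j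
  have h2 : f 2 = 2 := map_ofNat f 2
  have h3 : f 3 = 3 := map_ofNat f 3
  fin_cases i <;> fin_cases j <;> simp [cubicMatrix, h2, h3]

/-- The rows are the reduced coefficients of `p, z p, z ^ 2 p, z ^ 3 p`, so a zero of `p` at `z`
puts `(1, z, z ^ 2, z ^ 3)` in the kernel. -/
lemma cubicMatrix_det_eq_zero {z : ℝ} (hz : z ^ 4 = 3 * z ^ 3 + 2 * z ^ 2 + 3) {a b c d : ℝ}
    (h : a + b * z + c * z ^ 2 + d * z ^ 3 = 0) : (cubicMatrix a b c d).det = 0 := by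
  rw [← Matrix.exists_mulVec_eq_zero_iff]
  refine ⟨![1, z, z ^ 2, z ^ 3], fun h0 => by simpa using congrFun h0 0, ?_⟩
  ext i
  fin_cases i <;> simp [cubicMatrix, Matrix.mulVec, dotProduct, Fin.sum_univ_four]
  · linear_combination h
  · linear_combination z * h - d * hz
  · linear_combination z ^ 2 * h - (d * z + c + 3 * d) * hz
  · linear_combination z ^ 3 * h -
      (d * z ^ 2 + (c + 3 * d) * z + (b + 2 * d + 3 * (c + 3 * d))) * hz

/-- Modulo 2 the quartic is `X ^ 4 + X ^ 3 + 1`, which is irreducible; the determinant is the norm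
from the field with 16 elements. -/
lemma cubicMatrix_det_zmod_two : ∀ a b c d : ZMod 2, (cubicMatrix a b c d).det = 0 →
    a = 0 ∧ b = 0 ∧ c = 0 ∧ d = 0 := by
  decide +kernel

/-- The powers `1, z, z ^ 2, z ^ 3` of a root are linearly independent over `ℤ`. -/
lemma cubic_coeffs_eq_zero {z : ℝ} (hz : z ^ 4 = 3 * z ^ 3 + 2 * z ^ 2 + 3) (n : ℕ) :
    ∀ a b c d : ℤ, a.natAbs + b.natAbs + c.natAbs + d.natAbs ≤ n →
      (a : ℝ) + b * z + c * z ^ 2 + d * z ^ 3 = 0 → a = 0 ∧ b = 0 ∧ c = 0 ∧ d = 0 := by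
  induction n with
  | zero => intro a b c d h _; omega
  | succ n ih =>
    intro a b c d hn h
    have h1 : (cubicMatrix a b c d).det = 0 := by
      have := cubicMatrix_map (Int.castRingHom ℝ) a b c d
      simp only [eq_intCast] at this
      rw [cubicMatrix_det_eq_zero hz h] at this
      exact_mod_cast this
    have h2 := cubicMatrix_map (Int.castRingHom (ZMod 2)) a b c d
    simp only [eq_intCast] at h2
    rw [h1, Int.cast_zero] at h2
    obtain ⟨ha, hb, hc, hd⟩ := cubicMatrix_det_zmod_two _ _ _ _ h2.symm
    rw [ZMod.intCast_zmod_eq_zero_iff_dvd _ 2] at ha hb hc hd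
    obtain ⟨a, rfl⟩ := ha
    obtain ⟨b, rfl⟩ := hb
    obtain ⟨c, rfl⟩ := hc
    obtain ⟨d, rfl⟩ := hd
    push_cast at h hn
    -- Infinite descent: a relation has even coefficients, and halving them gives a smaller relation
    -- unless all vanish.
    by_cases hall : a = 0 ∧ b = 0 ∧ c = 0 ∧ d = 0
    · obtain ⟨rfl, rfl, rfl, rfl⟩ := hall
      simp
    · exact absurd (ih a b c d (by omega) (by linear_combination h / 2)) hall

/-- Cubic integer polynomials that agree at one root agree at any other root. -/
lemma cubicEval_eq_of_eq {z y : ℝ} (hz : z ^ 4 = 3 * z ^ 3 + 2 * z ^ 2 + 3)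
    {v w : ℤ × ℤ × ℤ × ℤ} (h : cubicEval z v = cubicEval z w) : cubicEval y v = cubicEval y w := by
  simp only [cubicEval] at h ⊢
  obtain ⟨h1, h2, h3, h4⟩ := cubic_coeffs_eq_zero hz _ (v.1 - w.1) (v.2.1 - w.2.1)
    (v.2.2.1 - w.2.2.1) (v.2.2.2 - w.2.2.2) le_rfl (by push_cast; linear_combination h)
  rw [sub_eq_zero.1 h1, sub_eq_zero.1 h2, sub_eq_zero.1 h3, sub_eq_zero.1 h4]

/-! ### The orbit of `1 / 2` -/

/-- The coefficients of twice the remainders of `1 / 2`, for a given sequence of digits. -/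
def remainderCoeffs (d : ℕ → ℕ) : ℕ → ℤ × ℤ × ℤ × ℤ
  | 0 => (1, 0, 0, 0)
  | n + 1 => mulRootSub (d n) (remainderCoeffs d n)

lemma remainderCoeffs_congr {d e : ℕ → ℕ} (n : ℕ) (h : ∀ i < n, d i = e i) :
    remainderCoeffs d n = remainderCoeffs e n := by
  induction n with
  | zero => rfl
  | succ n ih =>
    rw [remainderCoeffs, remainderCoeffs, h n (by omega), ih fun i hi => h i (by omega)]

lemma cubicEval_remainderCoeffs {β : ℝ} (hβ : β ^ 4 = 3 * β ^ 3 + 2 * β ^ 2 + 3) (h1 : 1 < β)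
    (n : ℕ) : cubicEval β (remainderCoeffs (greedyDigit β (1 / 2)) n)
      = 2 * greedyRemainder β (1 / 2) n := by
  induction n with
  | zero => simp [remainderCoeffs, cubicEval, greedyRemainder]
  | succ n ih =>
    rw [remainderCoeffs, cubicEval_mulRootSub hβ, ih,
      greedyRemainder_succ h1 (by norm_num) (by norm_num)]
    push_cast
    ring

/-- The first thirty digits of the expansion of `1 / 2`. -/
def halfDigits (n : ℕ) : ℕ :=
  [1, 2, 3, 1, 0, 2, 3, 0, 3, 0, 0, 1, 0, 1, 0, 2, 2, 0, 1, 2, 3, 2, 0, 0, 0, 1, 3, 0, 2, 1].getD n 0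

/-- Approximation of `10 ^ 5` times the value of a cubic polynomial at the dominant root. -/
def approxEval (v : ℤ × ℤ × ℤ × ℤ) : ℤ :=
  v.1 * 100000 + v.2.1 * 361645 + v.2.2.1 * 1307874 + v.2.2.2 * 4729868

/-- Error bound for `approxEval`. -/
def approxError (v : ℤ × ℤ × ℤ × ℤ) : ℤ := |v.2.1| + |v.2.2.1| + |v.2.2.2|

lemma abs_cubicEval_sub_approxEval_le {β : ℝ} (h1 : 3.6164545 ≤ β) (h2 : β ≤ 3.6164546)
    (v : ℤ × ℤ × ℤ × ℤ) :
    |100000 * cubicEval β v - approxEval v| ≤ approxError v := by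
  have key (k : ℤ) {t : ℝ} (ht : |t| ≤ 1) : |k * t| ≤ |(k : ℝ)| := by
    rw [abs_mul]; exact mul_le_of_le_one_right (abs_nonneg _) ht
  have p2 : 3.6164545 ^ 2 ≤ β ^ 2 := by gcongr
  have p2' : β ^ 2 ≤ 3.6164546 ^ 2 := by gcongr
  have p3 : 3.6164545 ^ 3 ≤ β ^ 3 := by gcongr
  have p3' : β ^ 3 ≤ 3.6164546 ^ 3 := by gcongr
  have k1 := key v.2.1 (t := 100000 * β - 361645) (by
    rw [abs_le]; constructor <;> norm_num at * <;> linarith)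
  have k2 := key v.2.2.1 (t := 100000 * β ^ 2 - 1307874) (by
    rw [abs_le]; constructor <;> norm_num at * <;> linarith)
  have k3 := key v.2.2.2 (t := 100000 * β ^ 3 - 4729868) (by
    rw [abs_le]; constructor <;> norm_num at * <;> linarith)
  have e : 100000 * cubicEval β v - approxEval v = v.2.1 * (100000 * β - 361645)
      + v.2.2.1 * (100000 * β ^ 2 - 1307874) + v.2.2.2 * (100000 * β ^ 3 - 4729868) := by
    simp only [cubicEval, approxEval]
    push_cast
    ring
  rw [e, approxError]
  push_cast
  exact (abs_add_three _ _ _).trans (by linarith)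

/-- Certifies the digits in integer arithmetic. `mulRootSub 0` is multiplication by the root alone,
and the factor `200000` combines the scale `10 ^ 5` with the doubling of the remainders. -/
lemma halfDigits_bounds : ∀ n < 30,
    200000 * (halfDigits n : ℤ) ≤ approxEval (mulRootSub 0 (remainderCoeffs halfDigits n))
        - approxError (mulRootSub 0 (remainderCoeffs halfDigits n)) ∧
      approxEval (mulRootSub 0 (remainderCoeffs halfDigits n))
        + approxError (mulRootSub 0 (remainderCoeffs halfDigits n))
        < 200000 * ((halfDigits n : ℤ) + 1) := by
  decide +kernel

lemma greedyDigit_half_eq {β : ℝ} (hβ : β ^ 4 = 3 * β ^ 3 + 2 * β ^ 2 + 3)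
    (h1 : 3.6164545 ≤ β) (h2 : β ≤ 3.6164546) (n : ℕ) (hn : n < 30) :
    greedyDigit β (1 / 2) n = halfDigits n := by
  induction n using Nat.strong_induction_on with
  | _ n ih =>
    have hb : 1 < β := by norm_num at h1; linarith
    have e := cubicEval_mulRootSub hβ 0 (remainderCoeffs halfDigits n)
    rw [← remainderCoeffs_congr n fun i hi => ih i hi (by omega),
      cubicEval_remainderCoeffs hβ hb,
      remainderCoeffs_congr n fun i hi => ih i hi (by omega)] at e
    have h3 := abs_le.1 (abs_cubicEval_sub_approxEval_le h1 h2
      (mulRootSub 0 (remainderCoeffs halfDigits n)))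
    obtain ⟨h4, h5⟩ := halfDigits_bounds n hn
    rify at h4 h5
    rw [e] at h3
    push_cast at h3
    rw [greedyDigit, Nat.floor_eq_iff (mul_nonneg (by positivity)
      (greedyRemainder_mem (by norm_num) (by norm_num) n).1)]
    constructor <;> linarith [h3.1, h3.2]

lemma greedyDigit_half_le_three {β : ℝ} (h1 : 1 < β) (h2 : β < 4) (n : ℕ) :
    greedyDigit β (1 / 2) n ≤ 3 := by
  have h := greedyRemainder_mem (β := β) (x := 1 / 2) (by norm_num) (by norm_num) n
  have h3 : greedyDigit β (1 / 2) n < 4 := by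
    rw [greedyDigit, Nat.floor_lt (mul_nonneg (by positivity) h.1)]
    push_cast
    nlinarith [h.1, h.2]
  omega

/-- The `β`-expansion of `1 / 2` is aperiodic: the conjugates of the remainders are unbounded. -/
theorem not_isUltimatelyPeriodic_greedyDigit_half {β : ℝ}
    (hβ : β ^ 4 = 3 * β ^ 3 + 2 * β ^ 2 + 3) (h1 : 3.6164545 ≤ β) (h2 : β ≤ 3.6164546) :
    ¬ IsUltimatelyPeriodic (greedyDigit β (1 / 2)) := by
  rintro ⟨N, p, hp, h⟩
  have hb : 1 < β := by norm_num at h1; linarith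
  have hb4 : β < 4 := by norm_num at h2; linarith
  obtain ⟨γ, hγ1, hγ2, hγ⟩ := exists_negative_root
  set g : ℕ → ℝ := fun n => cubicEval γ (remainderCoeffs (greedyDigit β (1 / 2)) n) with hg
  have hstep (n : ℕ) : g (n + 1) = γ * g n - 2 * greedyDigit β (1 / 2) n := by
    simp only [hg, remainderCoeffs, cubicEval_mulRootSub hγ, Int.cast_natCast]
  -- Strict growth needs `1.096 * t - 6 > t`, that is `t > 62.5`, where 6 is twice the largest
  -- digit; 80 leaves a margin.
  have hbig : 80 ≤ |g 30| := by
    have hc : remainderCoeffs halfDigits 30 = (19, -16, 32, -8) := by decide +kernel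
    simp only [hg, remainderCoeffs_congr 30 (greedyDigit_half_eq hβ h1 h2), hc, cubicEval]
    norm_num at hγ1 hγ2 ⊢
    refine le_trans ?_ (le_abs_self _)
    have q2 : (1.096 : ℝ) ^ 2 ≤ γ ^ 2 := by norm_num; nlinarith
    have q3 : γ ^ 3 ≤ -1.3 := by norm_num at q2 ⊢; nlinarith
    norm_num at q2 q3
    linarith
  have hgrow {n : ℕ} (hn : 80 ≤ |g n|) : |g n| < |g (n + 1)| := by
    have h3 : (greedyDigit β (1 / 2) n : ℝ) ≤ 3 := by
      exact_mod_cast greedyDigit_half_le_three hb hb4 n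
    have h4 : |γ * g n| - |2 * (greedyDigit β (1 / 2) n : ℝ)| ≤ |g (n + 1)| := by
      rw [hstep]; exact abs_sub_abs_le_abs_sub _ _
    rw [abs_mul, abs_of_nonneg (by positivity : 0 ≤ 2 * (greedyDigit β (1 / 2) n : ℝ))] at h4
    have h5 : 1.096 ≤ |γ| := by rw [abs_of_neg (by norm_num at hγ2; linarith)]; linarith
    norm_num at h5
    nlinarith
  have hall (k : ℕ) : 80 ≤ |g (30 + k)| := by
    induction k with
    | zero => exact hbig
    | succ k ih => exact ih.trans (hgrow ih).le
  have hmono : StrictMono fun k => |g (30 + k)| := strictMono_nat_of_lt_succ fun k => hgrow (hall k)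
  have hper : g (30 + N + p) = g (30 + N) := by
    refine cubicEval_eq_of_eq hβ ?_
    rw [cubicEval_remainderCoeffs hβ hb, cubicEval_remainderCoeffs hβ hb,
      greedyRemainder_periodic hb (by norm_num) (by norm_num) h (by omega)]
  have := hmono (show N < N + p by omega)
  simp only [← add_assoc, hper, lt_irrefl] at this

/-! ### The expansion of `1` -/

lemma isBetaExpansion_one {β : ℝ} (hβ : β ^ 4 = 3 * β ^ 3 + 2 * β ^ 2 + 3)
    (h1 : 3.6164545 ≤ β) (h2 : β ≤ 3.6164546) :
    IsBetaExpansion β 1 fun n => [3, 2, 0, 3].getD n 0 := by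
  have h0 : β ≠ 0 := by rintro rfl; norm_num at hβ
  norm_num at h1 h2
  have hb : 1 < β := by linarith
  -- Only the remainders after the initial one must be below 1, so the starting value 1 is allowed.
  -- The third remainder is `3 / β`, so the digit 3 ends the expansion.
  refine isBetaExpansion_of_remainders hb
    (r := fun n => [1, β - 3, β ^ 2 - 3 * β - 2, β ^ 3 - 3 * β ^ 2 - 2 * β].getD n 0) ?_ ?_
  · intro n
    match n with
    | 0 => simp
    | 1 => simp; ring
    | 2 => simp; ring
    | 3 => simp; linear_combination -hβ
    | n + 4 => simp
  · have e3 : β * (β ^ 3 - 3 * β ^ 2 - 2 * β) = 3 := by linear_combination hβ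
    have i3 : 0 < β ^ 3 - 3 * β ^ 2 - 2 * β := by
      by_contra! h
      nlinarith
    intro n
    match n with
    | 0 => simp; constructor <;> linarith
    | 1 => simp; constructor <;> nlinarith
    | 2 => simp; constructor <;> nlinarith
    | n + 3 => simp

/-- The sequence `(3202)^ω`. -/
def parryDigit (i : ℕ) : ℕ := if i % 4 = 3 then 2 else [3, 2, 0, 3].getD (i % 4) 0

lemma isModifiedExpansionOne_parryDigit {β : ℝ} (hβ : β ^ 4 = 3 * β ^ 3 + 2 * β ^ 2 + 3)
    (h1 : 3.6164545 ≤ β) (h2 : β ≤ 3.6164546) : IsModifiedExpansionOne β parryDigit := by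
  refine ⟨_, isBetaExpansion_one hβ h1 h2, Or.inl ⟨3, by simp, fun i hi => ?_, fun i => ?_⟩⟩
  · obtain ⟨j, rfl⟩ := Nat.exists_eq_add_of_lt hi
    simp [show 3 + j + 1 = j + 4 by ring]
  · simp [parryDigit]

lemma isUltimatelyPeriodic_parryDigit : IsUltimatelyPeriodic parryDigit :=
  ⟨0, 4, by norm_num, fun n _ => by simp [parryDigit]⟩

/-! ### The sequence `seqU` -/

lemma seqU_ratio_bounds (n : ℕ) : 3 * seqU n ≤ seqU (n + 1) ∧ seqU (n + 1) ≤ 4 * seqU n := by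
  induction n using Nat.strong_induction_on with
  | _ n ih =>
    match n with
    | 0 => decide
    | 1 => decide
    | 2 => decide
    | n + 3 =>
      have h0 := ih n (by omega)
      have h1 := ih (n + 1) (by omega)
      have h2 := ih (n + 2) (by omega)
      rw [show n + 3 + 1 = n + 4 by ring, seqU]
      simp only [add_assoc, Nat.reduceAdd] at *
      omega

lemma three_pow_le_seqU (n : ℕ) : 3 ^ n ≤ seqU n := by
  induction n with
  | zero => decide
  | succ n ih => have := (seqU_ratio_bounds n).1; rw [pow_succ]; omega

lemma seqU_pos (n : ℕ) : 0 < seqU n := (by positivity : 0 < 3 ^ n).trans_le (three_pow_le_seqU n)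

lemma seqU_strictMono : StrictMono seqU :=
  strictMono_nat_of_lt_succ fun n => by
    have := (seqU_ratio_bounds n).1
    have := seqU_pos n
    omega

lemma isNumerationSystem_seqU : IsNumerationSystem seqU := by
  refine ⟨seqU_strictMono, rfl, 4, ?_⟩
  rintro _ ⟨n, rfl⟩
  have h := (seqU_ratio_bounds n).2
  have h0 : (0 : ℚ) < seqU n := by exact_mod_cast seqU_pos n
  rw [Nat.ceil_le, div_le_iff₀ h0]
  exact_mod_cast h

lemma seqU_eq_sum (n : ℕ) :
    seqU n = ∑ i ∈ Finset.range n, parryDigit i * seqU (n - 1 - i) + 1 := by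
  induction n using Nat.strong_induction_on with
  | _ n ih =>
    match n with
    | 0 => decide
    | 1 => decide
    | 2 => decide
    | 3 => decide
    | n + 4 =>
      have h := ih n (by omega)
      have e (i : ℕ) : parryDigit (i + 4) = parryDigit i := by simp [parryDigit]
      rw [seqU, Finset.sum_range_succ', Finset.sum_range_succ', Finset.sum_range_succ',
        Finset.sum_range_succ']
      -- By periodicity the tail of the sum is `seqU n - 1`; with the fourth digit 2 this produces
      -- the coefficient 3 of `seqU n`.
      have e2 : ∑ k ∈ Finset.range n, parryDigit (k + 1 + 1 + 1 + 1)
          * seqU (n + 4 - 1 - (k + 1 + 1 + 1 + 1))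
          = ∑ k ∈ Finset.range n, parryDigit k * seqU (n - 1 - k) :=
        Finset.sum_congr rfl fun k hk => by
          rw [show k + 1 + 1 + 1 + 1 = k + 4 by ring, e]
          congr 2
          omega
      rw [e2]
      simp [show parryDigit 0 = 3 from rfl, show parryDigit 1 = 2 from rfl,
        show parryDigit 2 = 0 from rfl, show parryDigit 3 = 2 from rfl]
      omega

lemma isCanonicalSystem_seqU {β : ℝ} (hβ : β ^ 4 = 3 * β ^ 3 + 2 * β ^ 2 + 3)
    (h1 : 3.6164545 ≤ β) (h2 : β ≤ 3.6164546) : IsCanonicalSystem β seqU :=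
  ⟨parryDigit, isModifiedExpansionOne_parryDigit hβ h1 h2, seqU_eq_sum⟩

/-- If `seqU n` and `seqU (n + 3)` are odd, the recurrence makes `seqU (n + 4)` even. -/
lemma exists_even_seqU (n : ℕ) : ∃ m, n ≤ m ∧ Even (seqU m) := by
  by_contra! h
  have h0 := Nat.not_even_iff_odd.1 (h n le_rfl)
  have h3 := Nat.not_even_iff_odd.1 (h (n + 3) (by omega))
  have h4 := Nat.not_even_iff_odd.1 (h (n + 4) (by omega))
  rw [seqU] at h4
  rw [Nat.odd_iff] at *
  omega

/-! ### Greedy words -/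

/-- Greedy words, possibly with leading zeros. -/
def IsGreedyWord (U : ℕ → ℕ) (w : List (Digit U)) : Prop :=
  ∀ v : List (Digit U), v <:+ w → v ≠ [] → wordVal U v < U v.length

section GreedyWords

variable {U : ℕ → ℕ}

lemma isGreedyWord_nil : IsGreedyWord U [] := fun _ hv hne =>
  absurd (List.suffix_nil.1 hv) hne

lemma isGreedyWord_cons {a : Digit U} {w : List (Digit U)} :
    IsGreedyWord U (a :: w) ↔ wordVal U (a :: w) < U (w.length + 1) ∧ IsGreedyWord U w := by
  constructor
  · intro h
    exact ⟨h _ List.suffix_rfl (by simp),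
      fun v hv hne => h v (hv.trans (List.suffix_cons a w)) hne⟩
  · rintro ⟨h1, h2⟩ v hv hne
    rcases List.suffix_cons_iff.1 hv with rfl | hv
    · exact h1
    · exact h2 v hv hne

lemma IsGreedyWord.drop {w : List (Digit U)} (h : IsGreedyWord U w) (i : ℕ) :
    IsGreedyWord U (w.drop i) :=
  fun v hv hne => h v (hv.trans (List.drop_suffix i w)) hne

lemma IsGreedyWord.wordVal_lt (h0 : U 0 = 1) {w : List (Digit U)} (h : IsGreedyWord U w) :
    wordVal U w < U w.length := by
  cases w with
  | nil => simp [wordVal, h0]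
  | cons a w => exact h _ List.suffix_rfl (by simp)

lemma isGreedyRep_iff {n : ℕ} {w : List (Digit U)} : IsGreedyRep U n w ↔
    wordVal U w = n ∧ (∀ a ∈ w.head?, (a : ℕ) ≠ 0) ∧ IsGreedyWord U w := Iff.rfl

lemma IsNumerationSystem.le_alphabetSize_mul (hU : IsNumerationSystem U) (n : ℕ) :
    U (n + 1) ≤ alphabetSize U * U n := by
  have hpos : 0 < U n := by
    have := hU.1.monotone (Nat.zero_le n)
    rw [hU.2.1] at this
    omega
  have h : ⌈(U (n + 1) : ℚ) / (U n : ℚ)⌉₊ ≤ alphabetSize U := le_ciSup hU.2.2 n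
  rw [Nat.ceil_le, div_le_iff₀ (by exact_mod_cast hpos)] at h
  exact_mod_cast h

lemma IsNumerationSystem.pos (hU : IsNumerationSystem U) (n : ℕ) : 0 < U n := by
  have := hU.1.monotone (Nat.zero_le n)
  rw [hU.2.1] at this
  omega

lemma exists_isGreedyWord (hU : IsNumerationSystem U) (n : ℕ) : ∀ m < U n,
    ∃ w : List (Digit U), w.length = n ∧ wordVal U w = m ∧ IsGreedyWord U w := by
  induction n with
  | zero =>
    intro m hm
    rw [hU.2.1, Nat.lt_one_iff] at hm
    exact ⟨[], rfl, hm.symm, isGreedyWord_nil⟩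
  | succ n ih =>
    intro m hm
    obtain ⟨w, hl, hv, hg⟩ := ih (m % U n) (Nat.mod_lt _ (hU.pos n))
    have hlt : m / U n < alphabetSize U := by
      rw [Nat.div_lt_iff_lt_mul (hU.pos n)]
      exact hm.trans_le (hU.le_alphabetSize_mul n)
    have hval : wordVal U (⟨m / U n, hlt⟩ :: w) = m := by
      rw [wordVal, hl, hv]
      exact Nat.div_add_mod' m (U n)
    refine ⟨⟨m / U n, hlt⟩ :: w, by simp [hl], hval, ?_⟩
    rw [isGreedyWord_cons, hval, hl]
    exact ⟨hm, hg⟩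

/-- Every number between `U k` and `U (k + 1)` has a greedy representation of length `k + 1`. -/
lemma exists_isGreedyRep_length (hU : IsNumerationSystem U) {k m : ℕ} (h1 : U k ≤ m)
    (h2 : m < U (k + 1)) : ∃ w, IsGreedyRep U m w ∧ w.length = k + 1 := by
  obtain ⟨w, hl, hv, hg⟩ := exists_isGreedyWord hU (k + 1) m h2
  refine ⟨w, ⟨hv, ?_, hg⟩, hl⟩
  intro a ha ha0
  cases w with
  | nil => simp at ha
  | cons b w =>
    simp only [List.head?_cons, Option.mem_def, Option.some.injEq] at ha
    subst ha
    have h3 := (isGreedyWord_cons.1 hg).2.wordVal_lt hU.2.1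
    simp only [List.length_cons, add_left_inj] at hl
    rw [wordVal, ha0, zero_mul, zero_add] at hv
    rw [hl] at h3
    omega

lemma exists_isGreedyRep (hU : IsNumerationSystem U) (m : ℕ) : ∃ w, IsGreedyRep U m w := by
  rcases Nat.eq_zero_or_pos m with rfl | hm
  · exact ⟨[], rfl, by simp, isGreedyWord_nil⟩
  · have hex : ∃ n, m < U n := ⟨m + 1, hU.1.le_apply.trans_lt (hU.1 (Nat.lt_succ_self m))⟩
    classical
    obtain ⟨k, hk⟩ : ∃ k, Nat.find hex = k + 1 := by
      refine Nat.exists_eq_succ_of_ne_zero fun h0 => ?_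
      have := Nat.find_spec hex
      rw [h0, hU.2.1] at this
      omega
    have h1 : U k ≤ m := not_lt.1 (Nat.find_min hex (show k < Nat.find hex by omega))
    have h2 : m < U (k + 1) := hk ▸ Nat.find_spec hex
    obtain ⟨w, hw, -⟩ := exists_isGreedyRep_length hU h1 h2
    exact ⟨w, hw⟩

/-- The tail has value below its weight `U w.length`, so the leading digit is a quotient of the
value by that weight. -/
lemma isGreedyWord_eq_of_wordVal_eq (hU : IsNumerationSystem U) {w : List (Digit U)} :
    ∀ {v : List (Digit U)}, IsGreedyWord U w → IsGreedyWord U v → w.length = v.length →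
      wordVal U w = wordVal U v → w = v := by
  induction w with
  | nil =>
    intro v _ _ hl _
    exact (List.length_eq_zero_iff.1 hl.symm).symm
  | cons a w ih =>
    intro v hw hv hl he
    cases v with
    | nil => simp at hl
    | cons b v =>
      simp only [List.length_cons, add_left_inj] at hl
      rw [isGreedyWord_cons] at hw hv
      have h1 := hw.2.wordVal_lt hU.2.1
      have h2 := hv.2.wordVal_lt hU.2.1
      rw [wordVal, wordVal, hl] at he
      rw [hl] at h1
      have hp := hU.pos v.length
      have hab : (a : ℕ) = b := by
        have e1 := congrArg (· / U v.length) he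
        rw [mul_comm, mul_comm (b : ℕ)] at e1
        simpa only [Nat.mul_add_div hp, Nat.div_eq_of_lt h1, Nat.div_eq_of_lt h2, add_zero] using e1
      rw [hab] at he
      rw [Fin.ext hab, ih hw.2 hv.2 hl (by omega)]

lemma IsGreedyRep.le_and_lt {m k : ℕ} {w : List (Digit U)}
    (h : IsGreedyRep U m w) (hl : w.length = k + 1) : U k ≤ m ∧ m < U (k + 1) := by
  obtain ⟨rfl, hh, hg⟩ := h
  cases w with
  | nil => simp at hl
  | cons a w =>
    simp only [List.length_cons, add_left_inj] at hl
    have ha : 0 < (a : ℕ) := Nat.pos_of_ne_zero (hh a rfl)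
    refine ⟨?_, hl ▸ (isGreedyWord_cons.1 hg).1⟩
    rw [wordVal, hl]
    exact (Nat.le_mul_of_pos_left _ ha).trans (Nat.le_add_right _ _)

/-- Greedy representations are unique. -/
lemma IsGreedyRep.unique (hU : IsNumerationSystem U) {m : ℕ} {w v : List (Digit U)}
    (hw : IsGreedyRep U m w) (hv : IsGreedyRep U m v) : w = v := by
  have key {w v : List (Digit U)} (hw : IsGreedyRep U m w) (hv : IsGreedyRep U m v) :
      w.length ≤ v.length := by
    by_contra! hlt
    obtain ⟨k, hk⟩ := Nat.exists_eq_succ_of_ne_zero (by omega : w.length ≠ 0)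
    have h1 := (hw.le_and_lt hk).1
    have h2 := (isGreedyRep_iff.1 hv).2.2.wordVal_lt hU.2.1
    rw [hv.1] at h2
    have h3 := hU.1.monotone (show v.length ≤ k by omega)
    omega
  exact isGreedyWord_eq_of_wordVal_eq hU hw.2.2 hv.2.2 (le_antisymm (key hw hv) (key hv hw))
    (hw.1.trans hv.1.symm)

end GreedyWords

/-! ### The language of greedy words of `seqU` is regular -/

/-- The purely periodic expansion of `1`, indexed by its period. -/
def parryState : Fin 4 → ℕ := ![3, 2, 0, 2]

/-- The number of words of length `n` accepted from the state `s`. -/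
def acceptCount : ℕ → Fin 4 → ℕ
  | 0, _ => 1
  | n + 1, s => parryState s * seqU n + acceptCount n (s + 1)

lemma acceptCount_zero (n : ℕ) : acceptCount n 0 = seqU n := by
  induction n using Nat.strong_induction_on with
  | _ n ih =>
    match n with
    | 0 => decide
    | 1 => decide
    | 2 => decide
    | 3 => decide
    | n + 4 =>
      simp only [acceptCount]
      rw [show (0 + 1 + 1 + 1 + 1 : Fin 4) = 0 from rfl, ih n (by omega), seqU]
      simp [parryState]
      omega

lemma acceptCount_pos (n : ℕ) (s : Fin 4) : 0 < acceptCount n s := by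
  induction n generalizing s with
  | zero => simp [acceptCount]
  | succ n ih => have := ih (s + 1); simp only [acceptCount]; omega

/-- Needed so that a digit exceeding `parryState s` always overshoots the bound. Away from state 0
the digit is at most 2, while `seqU` at least triples. -/
lemma acceptCount_le (n : ℕ) (s : Fin 4) : acceptCount n s ≤ seqU n := by
  induction n generalizing s with
  | zero => simp [acceptCount, seqU]
  | succ n ih =>
    by_cases hs : s = 0
    · rw [hs, acceptCount_zero]
    · have h1 := ih (s + 1)
      have h2 := (seqU_ratio_bounds n).1
      have h3 : parryState s ≤ 2 := by fin_cases s <;> simp_all [parryState]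
      have h4 := Nat.mul_le_mul_right (seqU n) h3
      simp only [acceptCount]
      omega

/-- The transitions of the automaton of the `β`-shift. -/
def parryStep : Option (Fin 4) → Digit seqU → Option (Fin 4)
  | none, _ => none
  | some s, a =>
    if (a : ℕ) < parryState s then some 0
    else if (a : ℕ) = parryState s then some (s + 1) else none

lemma foldl_parryStep_none (w : List (Digit seqU)) : w.foldl parryStep none = none := by
  induction w with
  | nil => rfl
  | cons a w ih => simpa [parryStep] using ih

/-- A smaller digit frees the rest of the word to be any greedy word; an equal digit passes the
remaining bound to the next state; a larger one is already too big. -/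
lemma foldl_parryStep_ne_none (w : List (Digit seqU)) (s : Fin 4) :
    w.foldl parryStep (some s) ≠ none ↔
      IsGreedyWord seqU w ∧ wordVal seqU w < acceptCount w.length s := by
  induction w generalizing s with
  | nil => simp [isGreedyWord_nil, wordVal, acceptCount]
  | cons a w ih =>
    have hle := acceptCount_le (w.length + 1) s
    have hval {h : IsGreedyWord seqU w} := h.wordVal_lt rfl
    have hpos := acceptCount_pos w.length (s + 1)
    have hle' := acceptCount_le w.length (s + 1)
    rw [isGreedyWord_cons, List.foldl_cons, parryStep, List.length_cons]
    have hred : ((wordVal seqU (a :: w) < seqU (w.length + 1) ∧ IsGreedyWord seqU w) ∧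
        wordVal seqU (a :: w) < acceptCount (w.length + 1) s) ↔
        IsGreedyWord seqU w ∧ wordVal seqU (a :: w) < acceptCount (w.length + 1) s :=
      ⟨fun h => ⟨h.1.2, h.2⟩, fun h => ⟨⟨h.2.trans_le hle, h.1⟩, h.2⟩⟩
    rw [hred, acceptCount, wordVal]
    split_ifs with h1 h2
    · rw [ih, acceptCount_zero]
      refine and_congr_right fun h => ⟨fun h3 => ?_, fun _ => hval (h := h)⟩
      have := Nat.mul_le_mul_right (seqU w.length) h1
      rw [Nat.succ_mul] at this
      omega
    · rw [ih, h2]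
      exact and_congr_right fun h => by omega
    · rw [foldl_parryStep_none]
      simp only [ne_eq, not_true_eq_false, false_iff, not_and, not_lt]
      intro _
      have h3 : parryState s + 1 ≤ (a : ℕ) := by omega
      have := Nat.mul_le_mul_right (seqU w.length) h3
      rw [Nat.succ_mul] at this
      omega

lemma isRegular_of_foldl {A σ : Type} [Finite σ] (f : σ → A → σ) (s : σ) (T : Set σ) :
    Language.IsRegular {w : List A | w.foldl f s ∈ T} := by
  have := Fintype.ofFinite σ
  exact ⟨σ, inferInstance, ⟨f, s, T⟩, rfl⟩

lemma isRegular_isGreedyWord : Language.IsRegular {w | IsGreedyWord seqU w} := by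
  have h := isRegular_of_foldl parryStep (some 0) {none}ᶜ
  refine cast (congrArg _ (Set.ext fun w => ?_)) h
  change w.foldl parryStep (some 0) ≠ none ↔ IsGreedyWord seqU w
  rw [foldl_parryStep_ne_none, acceptCount_zero]
  exact ⟨And.left, fun h => ⟨h, h.wordVal_lt rfl⟩⟩

lemma isRegular_head_ne_zero {k : ℕ} :
    Language.IsRegular {w : List (Fin k) | ∀ a ∈ w.head?, (a : ℕ) ≠ 0} := by
  -- The state is `none` before any letter and then records forever whether the first letter was
  -- zero.
  let f : Option Bool → Fin k → Option Bool := fun s a =>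
    some (s.getD (decide ((a : ℕ) = 0)))
  have hf (w : List (Fin k)) (b : Bool) : w.foldl f (some b) = some b := by
    induction w with
    | nil => rfl
    | cons a w ih => simpa [f] using ih
  have h := isRegular_of_foldl f none {some true}ᶜ
  refine cast (congrArg _ (Set.ext fun w => ?_)) h
  change w.foldl f none ≠ some true ↔ ∀ a ∈ w.head?, (a : ℕ) ≠ 0
  cases w with
  | nil => simp
  | cons a w =>
    rw [List.foldl_cons, show f none a = some (decide ((a : ℕ) = 0)) from rfl, hf]
    simp

/-- The fibres of a `U`-automatic sequence are `U`-recognizable. -/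
lemma IsAutomatic.isRecognizable {B : Type} {x : ℕ → B} (h : IsAutomatic seqU x) (b : B) :
    IsRecognizable seqU {n | x n = b} := by
  obtain ⟨Q, _, M, -, hM⟩ := h
  have h1 := (isRegular_isGreedyWord.inf isRegular_head_ne_zero).inf
    (isRegular_of_foldl M.step M.start {q | M.out q = b})
  refine cast (congrArg Language.IsRegular (Set.ext fun w => ?_)) h1
  change ((IsGreedyWord seqU w ∧ ∀ a ∈ w.head?, (a : ℕ) ≠ 0) ∧ M.eval w = b) ↔
    ∃ n, x n = b ∧ IsGreedyRep seqU n w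
  constructor
  · rintro ⟨⟨hg, hh⟩, hb⟩
    obtain ⟨v, hv, hx⟩ := hM (wordVal seqU w)
    have hw : IsGreedyRep seqU (wordVal seqU w) w := ⟨rfl, hh, hg⟩
    rw [hv.unique isNumerationSystem_seqU hw] at hx
    exact ⟨_, hx.trans hb, hw⟩
  · rintro ⟨n, hb, hw⟩
    obtain ⟨v, hv, hx⟩ := hM n
    rw [hv.unique isNumerationSystem_seqU hw] at hx
    exact ⟨⟨hw.2.2, hw.2.1⟩, hx.symm.trans hb⟩

/-! ### The characteristic sequence of `seqU` -/

lemma one_lt_alphabetSize : 1 < alphabetSize seqU := by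
  have := isNumerationSystem_seqU.le_alphabetSize_mul 0
  simp only [seqU] at this
  omega

/-- The digit `0`. -/
noncomputable def digitZero : Digit seqU := ⟨0, by have := one_lt_alphabetSize; omega⟩

/-- The digit `1`. -/
noncomputable def digitOne : Digit seqU := ⟨1, one_lt_alphabetSize⟩

lemma wordVal_replicate_zero (k : ℕ) : wordVal seqU (List.replicate k digitZero) = 0 := by
  induction k with
  | zero => rfl
  | succ k ih => rw [List.replicate_succ, wordVal, ih]; simp [digitZero]

lemma isGreedyWord_replicate_zero (k : ℕ) :
    IsGreedyWord seqU (List.replicate k digitZero) := by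
  induction k with
  | zero => exact isGreedyWord_nil
  | succ k ih =>
    rw [List.replicate_succ, isGreedyWord_cons, ← List.replicate_succ, wordVal_replicate_zero]
    exact ⟨seqU_pos _, ih⟩

lemma isGreedyRep_seqU (k : ℕ) :
    IsGreedyRep seqU (seqU k) (digitOne :: List.replicate k digitZero) := by
  have hv : wordVal seqU (digitOne :: List.replicate k digitZero) = seqU k := by
    rw [wordVal, wordVal_replicate_zero]; simp [digitOne]
  refine ⟨hv, by simp [digitOne], isGreedyWord_cons.2 ⟨?_, isGreedyWord_replicate_zero k⟩⟩
  rw [hv, List.length_replicate]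
  exact seqU_strictMono (Nat.lt_succ_self k)

/-- The automaton that accepts the words `0 ⋯ 0 1 0 ⋯ 0`. The states `some false`, `some true` and
`none` mean that no nonzero digit, just the digit `1`, or anything else has been read. -/
def powerStep : Option Bool → Digit seqU → Option Bool
  | none, _ => none
  | some b, a => if (a : ℕ) = 0 then some b else if (a : ℕ) = 1 ∧ b = false then some true else none

lemma foldl_powerStep_none (w : List (Digit seqU)) : w.foldl powerStep none = none := by
  induction w with
  | nil => rfl
  | cons a w ih => simpa [powerStep] using ih

lemma foldl_powerStep_replicate (k : ℕ) (b : Bool) :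
    (List.replicate k digitZero).foldl powerStep (some b) = some b := by
  induction k with
  | zero => rfl
  | succ k ih => simpa [List.replicate_succ, powerStep, digitZero] using ih

lemma wordVal_eq_zero_of_foldl_powerStep {w : List (Digit seqU)}
    (h : w.foldl powerStep (some true) = some true) : wordVal seqU w = 0 := by
  induction w with
  | nil => rfl
  | cons a w ih =>
    rw [List.foldl_cons, powerStep] at h
    split_ifs at h with h1 h2
    · rw [wordVal, h1, ih h]; simp
    · simp at h2
    · simp [foldl_powerStep_none] at h

lemma wordVal_mem_range_of_foldl_powerStep {w : List (Digit seqU)}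
    (h : w.foldl powerStep (some false) = some true) : wordVal seqU w ∈ Set.range seqU := by
  induction w with
  | nil => simp at h
  | cons a w ih =>
    rw [List.foldl_cons, powerStep] at h
    split_ifs at h with h1 h2
    · rw [wordVal, h1]; simpa using ih h
    · rw [wordVal, h2.1, wordVal_eq_zero_of_foldl_powerStep h]
      exact ⟨w.length, by simp⟩
    · simp [foldl_powerStep_none] at h

lemma isAutomatic_charSeq_range_seqU : IsAutomatic seqU (charSeq (Set.range seqU)) := by
  refine ⟨Option Bool, inferInstance,
    ⟨some false, powerStep, fun q => if q = some true then 1 else 0⟩, ?_, fun n => ?_⟩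
  · intro a ha
    simp [powerStep, ha]
  · by_cases hn : n ∈ Set.range seqU
    · obtain ⟨k, rfl⟩ := hn
      refine ⟨_, isGreedyRep_seqU k, ?_⟩
      have h1 : powerStep (some false) digitOne = some true := by simp [powerStep, digitOne]
      simp [DFAO.eval, h1, foldl_powerStep_replicate, charSeq]
    · obtain ⟨w, hw⟩ := exists_isGreedyRep isNumerationSystem_seqU n
      refine ⟨w, hw, ?_⟩
      have h1 : w.foldl powerStep (some false) ≠ some true := fun h =>
        hn (hw.1 ▸ wordVal_mem_range_of_foldl_powerStep h)
      simp [DFAO.eval, h1, charSeq, hn]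

/-! ### The growth of `seqU` -/

/-- Dividing the quartic by `X - β` gives a third-order recurrence for these errors with
coefficients in `[0, 1]` up to sign. Growth like `2 ^ n` suffices, since `4 + 2 + 1 ≤ 8`, and is
negligible against `3 ^ n ≤ seqU n`. -/
lemma abs_seqU_succ_sub_le {β : ℝ} (hβ : β ^ 4 = 3 * β ^ 3 + 2 * β ^ 2 + 3)
    (h1 : 3.6164545 ≤ β) (h2 : β ≤ 3.6164546) (n : ℕ) :
    |(seqU (n + 1) : ℝ) - β * seqU n| ≤ 10 * 2 ^ n := by
  norm_num at h1 h2
  have q1 : 13 ≤ β ^ 2 := by nlinarith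
  have q2 : β ^ 2 ≤ 13.1 := by norm_num; nlinarith
  have q3 : 47 ≤ β ^ 3 := by nlinarith
  have q4 : β ^ 3 ≤ 47.5 := by norm_num at q2 ⊢; nlinarith
  induction n using Nat.strong_induction_on with
  | _ n ih =>
    match n with
    | 0 => rw [abs_le]; norm_num [seqU]; constructor <;> linarith
    | 1 => rw [abs_le]; norm_num [seqU]; constructor <;> linarith
    | 2 => rw [abs_le]; norm_num [seqU]; constructor <;> linarith
    | n + 3 =>
      have i0 := ih n (by omega)
      have i1 := ih (n + 1) (by omega)
      have i2 := ih (n + 2) (by omega)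
      have hrec : (seqU (n + 4) : ℝ) = 3 * seqU (n + 3) + 2 * seqU (n + 2) + 3 * seqU n := by
        rw [seqU]; push_cast; ring
      simp only [add_assoc, Nat.reduceAdd] at *
      have e3 : β * (β ^ 3 - 3 * β ^ 2 - 2 * β) = 3 := by linear_combination hβ
      have c0 : 0 ≤ β ^ 3 - 3 * β ^ 2 - 2 * β ∧ β ^ 3 - 3 * β ^ 2 - 2 * β ≤ 1 := by
        constructor <;> nlinarith
      have c1 : 0 ≤ β ^ 2 - 3 * β - 2 ∧ β ^ 2 - 3 * β - 2 ≤ 1 := by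
        constructor <;> nlinarith
      have key : (seqU (n + 4) : ℝ) - β * seqU (n + 3)
          = -((β - 3) * (seqU (n + 3) - β * seqU (n + 2))
            + (β ^ 2 - 3 * β - 2) * (seqU (n + 2) - β * seqU (n + 1))
            + (β ^ 3 - 3 * β ^ 2 - 2 * β) * (seqU (n + 1) - β * seqU n)) := by
        rw [hrec]
        linear_combination (-(seqU n : ℝ)) * hβ
      rw [key, abs_neg]
      refine (abs_add_three _ _ _).trans ?_
      rw [abs_mul, abs_mul, abs_mul, abs_of_nonneg c0.1, abs_of_nonneg c1.1,
        abs_of_nonneg (by linarith : 0 ≤ β - 3)]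
      have k2 := mul_le_mul (by linarith : β - 3 ≤ 1) i2 (abs_nonneg _) zero_le_one
      have k1 := mul_le_mul c1.2 i1 (abs_nonneg _) zero_le_one
      have k0 := mul_le_mul c0.2 i0 (abs_nonneg _) zero_le_one
      have : (0 : ℝ) < 2 ^ n := by positivity
      rw [pow_add] at *
      linarith

lemma tendsto_seqU_ratio {β : ℝ} (hβ : β ^ 4 = 3 * β ^ 3 + 2 * β ^ 2 + 3)
    (h1 : 3.6164545 ≤ β) (h2 : β ≤ 3.6164546) :
    Tendsto (fun n => (seqU (n + 1) : ℝ) / seqU n) atTop (𝓝 β) := by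
  have hlim : Tendsto (fun n : ℕ => 10 * (2 / 3 : ℝ) ^ n) atTop (𝓝 0) := by
    simpa using (tendsto_pow_atTop_nhds_zero_of_lt_one (by norm_num : (0 : ℝ) ≤ 2 / 3)
      (by norm_num)).const_mul 10
  rw [tendsto_iff_dist_tendsto_zero]
  refine squeeze_zero (fun _ => dist_nonneg) (fun n => ?_) hlim
  have hp : (0 : ℝ) < seqU n := by exact_mod_cast seqU_pos n
  have h3 : (3 : ℝ) ^ n ≤ seqU n := by exact_mod_cast three_pow_le_seqU n
  have e : (seqU (n + 1) : ℝ) / seqU n - β = (seqU (n + 1) - β * seqU n) / seqU n := by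
    field_simp
  rw [Real.dist_eq, e, abs_div, abs_of_pos hp, div_pow, ← mul_div_assoc]
  exact div_le_div₀ (by positivity) (abs_seqU_succ_sub_le hβ h1 h2 n) (by positivity) h3

/-! ### The representations of the numbers `seqU n / 2` -/

/-- The length is `n`, one less than for `seqU n`, because the ratios are at least 3; for `n = 0`
the halved value is 0, with the empty word. -/
lemma exists_isGreedyRep_half (n : ℕ) :
    ∃ w, IsGreedyRep seqU (seqU n / 2) w ∧ w.length = n := by
  cases n with
  | zero => exact ⟨[], ⟨rfl, by simp, isGreedyWord_nil⟩, rfl⟩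
  | succ n =>
    have h1 := (seqU_ratio_bounds n).1
    have h2 := seqU_pos (n + 1)
    exact exists_isGreedyRep_length isNumerationSystem_seqU (by omega) (by omega)

lemma tendsto_seqU_half_ratio :
    Tendsto (fun n => ((seqU n / 2 : ℕ) : ℝ) / seqU n) atTop (𝓝 (1 / 2)) := by
  have h := tendsto_nat_floor_mul_div_atTop (R := ℝ) (a := 1 / 2) (by norm_num)
  have hU : Tendsto (fun n => (seqU n : ℝ)) atTop atTop :=
    tendsto_natCast_atTop_atTop.comp seqU_strictMono.tendsto_atTop
  refine (h.comp hU).congr fun n => ?_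
  have : ⌊1 / 2 * (seqU n : ℝ)⌋₊ = seqU n / 2 := by
    rw [one_div_mul_eq_div]
    exact_mod_cast Nat.floor_div_natCast (seqU n : ℝ) 2 |>.trans (by rw [Nat.floor_natCast])
  simp only [Function.comp_apply, this]

/-! ### Convergence of greedy words and regularity -/

section Convergence

variable {β x : ℝ} {U : ℕ → ℕ}

/-- If the leading parts of greedy words of length `n` converge to `x`, where the `β`-expansion of
`x` is infinite, then their digits converge to those of the `β`-expansion. -/
lemma tendsto_digits (hU : IsNumerationSystem U) (hβ : 1 < β)
    (hlim : Tendsto (fun n => (U (n + 1) : ℝ) / U n) atTop (𝓝 β)) (hx : 0 ≤ x) (hx' : x < 1)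
    (hne : ∀ n, greedyRemainder β x (n + 1) ≠ 0) {W : ℕ → List (Digit U)}
    (hg : ∀ n, IsGreedyWord U (W n)) (hl : ∀ n, (W n).length = n)
    (hW : Tendsto (fun n => (wordVal U (W n) : ℝ) / U n) atTop (𝓝 x)) (i : ℕ) :
    Tendsto (fun n => (wordVal U ((W n).drop i) : ℝ) / U (n - i)) atTop
        (𝓝 (greedyRemainder β x i)) ∧
      ∀ᶠ n in atTop, ((W n)[i]?).map Fin.val = some (greedyDigit β x i) := by
  have step {i : ℕ} (h : Tendsto (fun n => (wordVal U ((W n).drop i) : ℝ) / U (n - i)) atTop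
      (𝓝 (greedyRemainder β x i))) :
      Tendsto (fun n => (wordVal U ((W n).drop (i + 1)) : ℝ) / U (n - (i + 1))) atTop
        (𝓝 (greedyRemainder β x (i + 1))) ∧
      ∀ᶠ n in atTop, ((W n)[i]?).map Fin.val = some (greedyDigit β x i) := by
    have hr := greedyRemainder_succ hβ hx hx' i
    have hb := greedyRemainder_succ_mem (β := β) (x := x) i
    have hpos : 0 < greedyRemainder β x (i + 1) := lt_of_le_of_ne hb.1 (hne i).symm
    set d := greedyDigit β x i
    have hq : Tendsto (fun n => (U (n - (i + 1) + 1) : ℝ) / U (n - (i + 1))) atTop (𝓝 β) :=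
      hlim.comp (tendsto_sub_atTop_nat (i + 1))
    have hm := hq.mul h
    have hdig : ∀ n, i + 1 ≤ n → ∃ a : Digit U, (W n)[i]? = some a ∧
        (U (n - (i + 1) + 1) : ℝ) / U (n - (i + 1)) *
          ((wordVal U ((W n).drop i) : ℝ) / U (n - i))
          = a + (wordVal U ((W n).drop (i + 1)) : ℝ) / U (n - (i + 1)) ∧
        (wordVal U ((W n).drop (i + 1)) : ℝ) / U (n - (i + 1)) < 1 := by
      intro n hn
      have hi : i < (W n).length := by rw [hl]; omega
      refine ⟨(W n)[i], List.getElem?_eq_getElem hi, ?_, ?_⟩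
      · have p1 : (0 : ℝ) < U (n - (i + 1)) := by exact_mod_cast hU.pos _
        have p2 : (0 : ℝ) < U (n - i) := by exact_mod_cast hU.pos _
        rw [show n - (i + 1) + 1 = n - i by omega, List.drop_eq_getElem_cons hi, wordVal,
          List.length_drop, hl]
        push_cast
        field_simp
      · rw [div_lt_one (by exact_mod_cast hU.pos _)]
        have := ((hg n).drop (i + 1)).wordVal_lt hU.2.1
        rw [List.length_drop, hl] at this
        exact_mod_cast this
    have hev : ∀ᶠ n in atTop, (W n)[i]?.map Fin.val = some d ∧
        (U (n - (i + 1) + 1) : ℝ) / U (n - (i + 1)) *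
          ((wordVal U ((W n).drop i) : ℝ) / U (n - i)) - d
          = (wordVal U ((W n).drop (i + 1)) : ℝ) / U (n - (i + 1)) := by
      -- Since the next remainder is nonzero, the limit `β * greedyRemainder β x i` lies strictly
      -- between `d` and `d + 1`; digit plus a fraction in `[0, 1)` is eventually in that interval,
      -- so the digit is `d`.
      filter_upwards [eventually_ge_atTop (i + 1),
        hm.eventually (lt_mem_nhds (show (d : ℝ) < β * greedyRemainder β x i by linarith)),
        hm.eventually (gt_mem_nhds (show β * greedyRemainder β x i < d + 1 by linarith))]
        with n hn h1 h2
      obtain ⟨a, ha, he, h3⟩ := hdig n hn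
      have h4 : 0 ≤ (wordVal U ((W n).drop (i + 1)) : ℝ) / U (n - (i + 1)) := by positivity
      have had : (a : ℕ) = d := by
        rw [he] at h1 h2
        have k1 : (a : ℕ) < d + 1 := by
          have : ((a : ℕ) : ℝ) < d + 1 := by linarith
          exact_mod_cast this
        have k2 : d < (a : ℕ) + 1 := by
          have : (d : ℝ) < (a : ℕ) + 1 := by linarith
          exact_mod_cast this
        omega
      refine ⟨by rw [ha, Option.map_some, had], ?_⟩
      rw [he, had]
      ring
    refine ⟨?_, hev.mono fun n h => h.1⟩
    rw [hr]
    exact (hm.sub_const (d : ℝ)).congr' (hev.mono fun n h => h.2)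
  have hall (i : ℕ) : Tendsto (fun n => (wordVal U ((W n).drop i) : ℝ) / U (n - i)) atTop
      (𝓝 (greedyRemainder β x i)) := by
    induction i with
    | zero => simpa [greedyRemainder] using hW
    | succ i ih => exact (step ih).1
  exact ⟨hall i, (step (hall i)).2⟩

end Convergence

/-- A language whose words are taken from a sequence of words of length `n` that converges to an
aperiodic infinite word is regular only if it is finite. -/
lemma not_isRegular_of_tendsto_aperiodic {k : ℕ} {W : ℕ → List (Fin k)} {d : ℕ → ℕ}
    (hd : ¬ IsUltimatelyPeriodic d)
    (hW : ∀ i, ∀ᶠ n in atTop, ((W n)[i]?).map Fin.val = some (d i))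
    {L : Language (Fin k)} (hL : ∀ w ∈ L, w = W w.length)
    (hinf : ∀ N, ∃ w ∈ L, N ≤ w.length) : ¬ L.IsRegular := by
  rintro ⟨σ, _, M, rfl⟩
  obtain ⟨w, hw, hlen⟩ := hinf (Fintype.card σ)
  obtain ⟨a, b, c, -, -, hb, hsub⟩ := M.pumping_lemma hw hlen
  have hmem (j : ℕ) : a ++ (List.replicate j b).flatten ++ c ∈ M.accepts := by
    refine hsub (Language.mem_mul.2 ?_)
    refine ⟨a ++ (List.replicate j b).flatten, ?_, c, rfl, rfl⟩
    refine Language.mem_mul.2 ⟨a, rfl, (List.replicate j b).flatten, ?_, rfl⟩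
    exact Language.mem_kstar.2 ⟨List.replicate j b, rfl, fun y hy => List.eq_of_mem_replicate hy⟩
  have hb0 : 0 < b.length := List.length_pos_iff.2 hb
  refine hd ⟨a.length, b.length, hb0, fun i hi => ?_⟩
  obtain ⟨N, hN⟩ := eventually_atTop.1 ((hW i).and (hW (i + b.length)))
  have hlong (j : ℕ) : j ≤ (a ++ (List.replicate j b).flatten ++ c).length := by
    have := Nat.le_mul_of_pos_right j hb0
    simp only [List.length_append, List.length_flatten, List.map_replicate, List.sum_replicate,
      smul_eq_mul]
    omega
  have h1 := (hN _ (hlong N)).1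
  have h2 := (hN _ ((Nat.le_succ N).trans (hlong (N + 1)))).2
  rw [← hL _ (hmem _)] at h1 h2
  -- Beyond `a`, one more copy of `b` is just a shift by its length. Both pumped words are long
  -- enough to show the limit digits, so `d` has period `b.length` from `a.length` on.
  have hshift : (a ++ (List.replicate (N + 1) b).flatten ++ c)[i + b.length]?
      = (a ++ (List.replicate N b).flatten ++ c)[i]? := by
    rw [List.replicate_succ, List.flatten_cons]
    simp only [List.append_assoc]
    rw [List.getElem?_append_right (l₁ := a) (i := i) hi,
      List.getElem?_append_right (l₁ := a) (by omega),
      List.getElem?_append_right (l₁ := b) (by omega)]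
    congr 1
    omega
  rw [hshift, h1] at h2
  exact (Option.some.inj h2).symm

/-- No infinite set of numbers `seqU n / 2` is recognizable. -/
theorem not_isRecognizable_half (S : Set ℕ) (hS : ∀ N, ∃ n, N ≤ n ∧ n ∈ S) :
    ¬ IsRecognizable seqU {m | ∃ n ∈ S, m = seqU n / 2} := by
  obtain ⟨β, h1, h2, hβ⟩ := exists_dominant_root
  have hb : 1 < β := by norm_num at h1; linarith
  have hd := not_isUltimatelyPeriodic_greedyDigit_half hβ h1 h2
  choose W hW hl using exists_isGreedyRep_half
  -- A vanishing remainder would end the expansion in zeros, contradicting aperiodicity.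
  have hne (n : ℕ) : greedyRemainder β (1 / 2) (n + 1) ≠ 0 := by
    intro h0
    have hz (k : ℕ) : greedyRemainder β (1 / 2) (n + 1 + k) = 0 := by
      induction k with
      | zero => exact h0
      | succ k ih => rw [← add_assoc, greedyRemainder, ih]; simp
    refine hd ⟨n + 1, 1, one_pos, fun m hm => ?_⟩
    obtain ⟨k, rfl⟩ := Nat.exists_eq_add_of_le hm
    rw [greedyDigit, greedyDigit, hz, add_assoc, hz]
  have hconv (i : ℕ) := (tendsto_digits isNumerationSystem_seqU hb
    (tendsto_seqU_ratio hβ h1 h2) (by norm_num) (by norm_num) hne (fun n => (hW n).2.2) hl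
    (by simpa only [(hW _).1] using tendsto_seqU_half_ratio) i).2
  refine not_isRegular_of_tendsto_aperiodic hd hconv ?_ fun N => ?_
  · rintro w ⟨_, ⟨n, -, rfl⟩, hw⟩
    have e := hw.unique isNumerationSystem_seqU (hW n)
    rw [e, hl]
  · obtain ⟨n, hn, hnS⟩ := hS N
    exact ⟨W n, ⟨_, ⟨n, hnS, rfl⟩, hW n⟩, by rw [hl]; exact hn⟩

/-! ### Failure of closure under periodic deletion -/

lemma not_isRecognizable_halfEvenU : ¬ IsRecognizable seqU halfEvenU :=
  not_isRecognizable_half {n | Even (seqU n)} exists_even_seqU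

lemma charSeq_eq_one_iff {X : Set ℕ} {n : ℕ} : charSeq X n = 1 ↔ n ∈ X := by
  rw [charSeq]
  split_ifs with h <;> simp [h]

lemma not_isAutomatic_charSeq_halfEvenU : ¬ IsAutomatic seqU (charSeq halfEvenU) := fun h =>
  not_isRecognizable_halfEvenU (by
    simpa only [charSeq_eq_one_iff, Set.ofPred_mem_eq] using h.isRecognizable 1)

lemma charSeq_halfEvenU (n : ℕ) :
    charSeq halfEvenU n = charSeq (Set.range seqU) (2 * n) := by
  have h : n ∈ halfEvenU ↔ 2 * n ∈ Set.range seqU := by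
    constructor
    · rintro ⟨k, hk, rfl⟩
      exact ⟨k, (Nat.two_mul_div_two_of_even hk).symm⟩
    · rintro ⟨k, hk⟩
      exact ⟨k, hk ▸ even_two_mul n, by omega⟩
  simp only [charSeq]
  congr 1
  exact propext h

theorem mainTheorem5 :
    IsNumerationSystem seqU ∧
    (∃ β : ℝ, IsGreatest {z : ℝ | z ^ 4 = 3 * z ^ 3 + 2 * z ^ 2 + 3} β ∧
      IsParryNumber β ∧ IsCanonicalSystem β seqU ∧
      ∃ d : ℕ → ℕ, IsBetaExpansion β (1 / 2) d ∧ ¬ IsUltimatelyPeriodic d) ∧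
    ¬ IsRecognizable seqU halfEvenU ∧
    ¬ IsRecognizable seqU (Set.range fun n : ℕ => seqU n / 2) ∧
    IsAutomatic seqU (charSeq (Set.range seqU)) ∧
    (∀ n : ℕ, charSeq halfEvenU n = charSeq (Set.range seqU) (2 * n)) ∧
    ¬ IsAutomatic seqU (charSeq halfEvenU) ∧
    ¬ ClosedUnderPeriodicDeletion seqU := by
  refine ⟨isNumerationSystem_seqU, ?_, not_isRecognizable_halfEvenU, ?_,
    isAutomatic_charSeq_range_seqU, charSeq_halfEvenU, not_isAutomatic_charSeq_halfEvenU, ?_⟩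
  · obtain ⟨β, h1, h2, hβ⟩ := exists_dominant_root
    have hb : 3.6 ≤ β := by norm_num at h1 ⊢; linarith
    have hb' : 1 < β := by norm_num at h1; linarith
    exact ⟨β, isGreatest_dominant_root hb hβ,
      ⟨hb', _, isModifiedExpansionOne_parryDigit hβ h1 h2, isUltimatelyPeriodic_parryDigit⟩,
      isCanonicalSystem_seqU hβ h1 h2, _,
      isBetaExpansion_greedyDigit hb' (by norm_num) (by norm_num),
      not_isUltimatelyPeriodic_greedyDigit_half hβ h1 h2⟩
  · have h := not_isRecognizable_half Set.univ fun N => ⟨N, le_rfl, trivial⟩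
    have e : {m | ∃ n ∈ Set.univ, m = seqU n / 2} = Set.range fun n : ℕ => seqU n / 2 := by
      ext m
      simp [eq_comm]
    rwa [e] at h
  · intro h
    have h2 := h (Fin 2) _ isAutomatic_charSeq_range_seqU 2 le_rfl
    exact not_isAutomatic_charSeq_halfEvenU (by simpa only [← charSeq_halfEvenU] using h2)
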